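/- Let $\mathbf{Meas}$ be the category of measurable spaces and measurable maps, and let $\mathcal G$ be the Giry monad on $\mathbf{Meas}$: $\mathcal G X$ is the set of probability measures on $X$ with the $\sigma$-algebra generated by the evaluations $\mu\mapsto\mu(S)$ for measurable $S\subseteq X$, $\mathcal G$ acts on measurable maps by pushforward, its unit is $x\mapsto\delta_x$, and its multiplication sends $P\in\mathcal G\mathcal G X$ to the measure $S\mapsto\int_{\mathcal G X}\nu(S)\,dP(\nu)$. Let $\mathcal D$ be the discrete distribution monad on $\mathbf{Set}$: $\mathcal D A=\{p\colon A\to[0,1]\mid\sum_{a\in A}p(a)=1\}$, with pushforward of distributions as action on maps, point masses as unit and averaging as multiplication. Equip $\mathcal D A$ with the $\sigma$-algebra induced from the power $[0,1]^A$ in $\mathbf{Meas}$, where $[0,1]$ carries its Borel $\sigma$-algebra. Let $\mathbf{Set}_{\mathsf c}$ be the category of countable (possibly finite or empty) sets and all maps, and let $\mathbf{Kl}_{\mathsf c}(\mathcal D)$ be the full subcategory of the Kleisli category of $\mathcal D$ on the countable sets, so that a morphism $A\to B$ is a map $f\colon A\to\mathcal D B$. This gives two functors to $\mathbf{Meas}$: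 $\mathcal D\colon\mathbf{Set}_{\mathsf c}\to\mathbf{Meas}$, and the forgetful functor $U_{\mathcal D}\colon\mathbf{Kl}_{\mathsf c}(\mathcal D)\to\mathbf{Meas}$, which sends $A$ to $\mathcal D A$ and $f\colon A\to\mathcal D B$ to the map $\mathcal D A\to\mathcal D B$, $p\mapsto\bigl(b\mapsto\sum_{a\in A}p(a)\,f(a)(b)\bigr)$. For a functor $F\colon\mathbf A\to\mathbf C$ whose right Kan extension $\mathrm{Ran}_F F$ along itself exists, with counit $\varphi\colon(\mathrm{Ran}_F F)F\to F$, the codensity monad of $F$ is $(\mathrm{Ran}_F F,\eta,\mu)$, where $\eta\colon\mathrm{Id}\to\mathrm{Ran}_F F$ and $\mu\colon(\mathrm{Ran}_F F)(\mathrm{Ran}_F F)\to\mathrm{Ran}_F F$ correspond, under the universal property of $\mathrm{Ran}_F F$, to $\mathrm{id}_F$ and to $\varphi\circ(\mathrm{Ran}_F F)\varphi$. **Theorem.** 1. The right Kan extension of $\mathcal D\colon\mathbf{Set}_{\mathsf c}\to\mathbf{Meas}$ along itself exists and is pointwise, and the Giry monad $\mathcal G$ is isomorphic, as a monad, to the codensity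 monad of $\mathcal D\colon\mathbf{Set}_{\mathsf c}\to\mathbf{Meas}$. 2. The right Kan extension of $U_{\mathcal D}\colon\mathbf{Kl}_{\mathsf c}(\mathcal D)\to\mathbf{Meas}$ along itself exists and is pointwise, and the Giry monad $\mathcal G$ is isomorphic, as a monad, to the codensity monad of $U_{\mathcal D}$. -/

import Mathlib

open CategoryTheory MeasureTheory

universe u v₁ v₂ u₁ u₂

noncomputable section

namespace Codensity

section General

variable {A : Type u₁} [Category.{v₁} A] {C : Type u₂} [Category.{v₂} C]

/-- The unit `𝟭 ⟶ Ran_F F`: the transformation corresponding to `id : F ⟶ F`. -/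
def unit (F : A ⥤ C) [F.HasRightKanExtension F] : 𝟭 C ⟶ F.rightKanExtension F :=
  (F.rightKanExtension F).liftOfIsRightKanExtension (F.rightKanExtensionCounit F) (𝟭 C)
    F.rightUnitor.hom

/-- The multiplication `(Ran_F F)(Ran_F F) ⟶ Ran_F F`: the transformation corresponding to
`(Ran_F F)(Ran_F F) F ⟶ (Ran_F F) F ⟶ F`, the counit applied twice. -/
def mult (F : A ⥤ C) [F.HasRightKanExtension F] :
    F.rightKanExtension F ⋙ F.rightKanExtension F ⟶ F.rightKanExtension F :=
  (F.rightKanExtension F).liftOfIsRightKanExtension (F.rightKanExtensionCounit F)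
    (F.rightKanExtension F ⋙ F.rightKanExtension F)
    ((Functor.associator _ _ _).inv ≫
      Functor.whiskerRight (F.rightKanExtensionCounit F) (F.rightKanExtension F) ≫
      F.rightKanExtensionCounit F)

theorem unit_fac (F : A ⥤ C) [F.HasRightKanExtension F] (a : A) :
    (unit F).app (F.obj a) ≫ (F.rightKanExtensionCounit F).app a = 𝟙 (F.obj a) := by
  simp [unit]

theorem mult_fac (F : A ⥤ C) [F.HasRightKanExtension F] (a : A) :
    (mult F).app (F.obj a) ≫ (F.rightKanExtensionCounit F).app a =
      (F.rightKanExtension F).map ((F.rightKanExtensionCounit F).app a) ≫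
        (F.rightKanExtensionCounit F).app a := by
  simp [mult]

/-- Two transformations into `Ran_F F` agree if they agree after composition with the counit. -/
theorem ran_hom_ext_app (F : A ⥤ C) [F.HasRightKanExtension F] {G : C ⥤ C}
    (γ₁ γ₂ : G ⟶ F.rightKanExtension F)
    (h : ∀ a, γ₁.app (F.obj a) ≫ (F.rightKanExtensionCounit F).app a =
      γ₂.app (F.obj a) ≫ (F.rightKanExtensionCounit F).app a) : γ₁ = γ₂ := by
  apply Functor.rightKanExtension_hom_ext
  ext a
  exact h a

/-- The codensity monad `(Ran_F F, η, μ)` of a functor `F` that has a right Kan extension along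
itself. -/
def codensityMonad (F : A ⥤ C) [F.HasRightKanExtension F] : Monad C where
  toFunctor := F.rightKanExtension F
  η := unit F
  μ := mult F
  assoc X := by
    let T := F.rightKanExtension F
    have := ran_hom_ext_app F (G := T ⋙ T ⋙ T)
      (Functor.whiskerRight (mult F) T ≫ mult F)
      (Functor.whiskerLeft T (mult F) ≫ mult F) (fun a => by
        have h1 := (mult F).naturality ((F.rightKanExtensionCounit F).app a)
        dsimp at h1
        simp only [NatTrans.comp_app, Functor.whiskerRight_app, Functor.whiskerLeft_app,
          Category.assoc, mult_fac, T]
        rw [← Functor.map_comp_assoc, mult_fac, ← reassoc_of% h1, mult_fac,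
          Functor.map_comp_assoc])
    exact NatTrans.congr_app this X
  left_unit X := by
    let T := F.rightKanExtension F
    have := ran_hom_ext_app F (G := T) (Functor.whiskerLeft T (unit F) ≫ mult F) (𝟙 T)
      (fun a => by
        have h1 := (unit F).naturality ((F.rightKanExtensionCounit F).app a)
        dsimp at h1
        simp only [NatTrans.comp_app, Functor.whiskerLeft_app, Category.assoc, mult_fac, T]
        erw [← reassoc_of% h1, unit_fac]
        simp)
    exact NatTrans.congr_app this X
  right_unit X := by
    let T := F.rightKanExtension F
    have := ran_hom_ext_app F (G := T) (Functor.whiskerRight (unit F) T ≫ mult F) (𝟙 T)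
      (fun a => by
        simp only [NatTrans.comp_app, Functor.whiskerRight_app, Category.assoc, mult_fac, T]
        rw [← Functor.map_comp_assoc]
        erw [unit_fac]
        simp)
    exact NatTrans.congr_app this X

/-- `T` is the codensity monad of `F`: the right Kan extension of `F` along itself exists, is
pointwise, and `T` is isomorphic to the codensity monad of `F` in the category of monads. -/
def IsCodensityMonadOf (T : Monad C) (F : A ⥤ C) : Prop :=
  ∃ _ : F.HasPointwiseRightKanExtension F, Nonempty (T ≅ codensityMonad F)

end General

section Giry

theorem measurable_prob_toMeasure {X : Type u} [MeasurableSpace X] :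
    Measurable (ProbabilityMeasure.toMeasure : ProbabilityMeasure X → Measure X) :=
  measurable_subtype_coe

theorem measurable_prob_coe {X : Type u} [MeasurableSpace X] {s : Set X} (hs : MeasurableSet s) :
    Measurable fun ν : ProbabilityMeasure X => (ν : Measure X) s :=
  (Measure.measurable_coe hs).comp measurable_prob_toMeasure

theorem measurable_of_measurable_prob_coe {X Y : Type u} [MeasurableSpace X] [MeasurableSpace Y]
    (f : Y → ProbabilityMeasure X)
    (h : ∀ s, MeasurableSet s → Measurable fun y => (f y : Measure X) s) : Measurable f :=
  Measurable.subtype_mk (Measure.measurable_of_measurable_coe _ h)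

theorem prob_ext {X : Type u} [MeasurableSpace X] {μ ν : ProbabilityMeasure X}
    (h : ∀ s, MeasurableSet s → (μ : Measure X) s = (ν : Measure X) s) : μ = ν :=
  Subtype.ext (Measure.ext h)

theorem isProbabilityMeasure_join {X : Type u} [MeasurableSpace X]
    (P : ProbabilityMeasure (ProbabilityMeasure X)) :
    IsProbabilityMeasure
      (Measure.join ((P : Measure (ProbabilityMeasure X)).map ProbabilityMeasure.toMeasure)) := by
  constructor
  rw [Measure.join_apply MeasurableSet.univ,
    lintegral_map (Measure.measurable_coe MeasurableSet.univ) measurable_prob_toMeasure]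
  simp

/-- The pushforward of a probability measure along a measurable map. -/
def probMap {X Y : Type u} [MeasurableSpace X] [MeasurableSpace Y] (f : X → Y) (hf : Measurable f)
    (μ : ProbabilityMeasure X) : ProbabilityMeasure Y :=
  μ.map hf.aemeasurable

/-- The Dirac measure as a probability measure. -/
def probDirac {X : Type u} [MeasurableSpace X] (x : X) : ProbabilityMeasure X :=
  ⟨Measure.dirac x, inferInstance⟩

/-- The averaging map `P ↦ (s ↦ ∫ ν s dP(ν))` on probability measures. -/
def probJoin {X : Type u} [MeasurableSpace X]
    (P : ProbabilityMeasure (ProbabilityMeasure X)) : ProbabilityMeasure X :=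
  ⟨Measure.join ((P : Measure (ProbabilityMeasure X)).map ProbabilityMeasure.toMeasure),
    isProbabilityMeasure_join P⟩

theorem probMap_apply {X Y : Type u} [MeasurableSpace X] [MeasurableSpace Y] {f : X → Y}
    (hf : Measurable f) (μ : ProbabilityMeasure X) {s : Set Y} (hs : MeasurableSet s) :
    (probMap f hf μ : Measure Y) s = (μ : Measure X) (f ⁻¹' s) :=
  Measure.map_apply hf hs

theorem lintegral_probMap {X Y : Type u} [MeasurableSpace X] [MeasurableSpace Y] {f : X → Y}
    (hf : Measurable f) (μ : ProbabilityMeasure X) {g : Y → ENNReal} (hg : Measurable g) :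
    ∫⁻ y, g y ∂(probMap f hf μ : Measure Y) = ∫⁻ x, g (f x) ∂(μ : Measure X) :=
  lintegral_map hg hf

theorem probJoin_apply {X : Type u} [MeasurableSpace X]
    (P : ProbabilityMeasure (ProbabilityMeasure X)) {s : Set X} (hs : MeasurableSet s) :
    (probJoin P : Measure X) s =
      ∫⁻ ν, (ν : Measure X) s ∂(P : Measure (ProbabilityMeasure X)) := by
  change Measure.join _ s = _
  rw [Measure.join_apply hs, lintegral_map (Measure.measurable_coe hs) measurable_prob_toMeasure]

theorem lintegral_probJoin {X : Type u} [MeasurableSpace X]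
    (P : ProbabilityMeasure (ProbabilityMeasure X)) {g : X → ENNReal} (hg : Measurable g) :
    ∫⁻ x, g x ∂(probJoin P : Measure X) =
      ∫⁻ ν, ∫⁻ x, g x ∂(ν : Measure X) ∂(P : Measure (ProbabilityMeasure X)) := by
  change ∫⁻ x, g x ∂(Measure.join _) = _
  rw [Measure.lintegral_join hg.aemeasurable,
    lintegral_map (Measure.measurable_lintegral hg) measurable_prob_toMeasure]

theorem measurable_probMap {X Y : Type u} [MeasurableSpace X] [MeasurableSpace Y] {f : X → Y}
    (hf : Measurable f) : Measurable (probMap f hf) :=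
  measurable_of_measurable_prob_coe _ fun s hs => by
    simp only [probMap_apply hf _ hs]
    exact measurable_prob_coe (hf hs)

theorem measurable_probDirac {X : Type u} [MeasurableSpace X] :
    Measurable (probDirac : X → ProbabilityMeasure X) :=
  Measurable.subtype_mk Measure.measurable_dirac

theorem measurable_probJoin {X : Type u} [MeasurableSpace X] :
    Measurable (probJoin : ProbabilityMeasure (ProbabilityMeasure X) → ProbabilityMeasure X) :=
  measurable_of_measurable_prob_coe _ fun s hs => by
    simp only [probJoin_apply _ hs]
    exact (Measure.measurable_lintegral (measurable_prob_coe hs)).comp measurable_prob_toMeasure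

theorem probMap_probDirac {X Y : Type u} [MeasurableSpace X] [MeasurableSpace Y] {f : X → Y}
    (hf : Measurable f) (x : X) : probMap f hf (probDirac x) = probDirac (f x) :=
  Subtype.ext (Measure.map_dirac' hf x)

theorem probJoin_probMap_probMap {X Y : Type u} [MeasurableSpace X] [MeasurableSpace Y]
    {f : X → Y} (hf : Measurable f) (P : ProbabilityMeasure (ProbabilityMeasure X)) :
    probJoin (probMap (probMap f hf) (measurable_probMap hf) P) = probMap f hf (probJoin P) :=
  prob_ext fun s hs => by
    rw [probMap_apply hf _ hs, probJoin_apply _ hs, probJoin_apply _ (hf hs),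
      lintegral_probMap _ _ (measurable_prob_coe hs)]
    exact lintegral_congr fun ν => probMap_apply hf ν hs

theorem probJoin_probMap_probJoin {X : Type u} [MeasurableSpace X]
    (P : ProbabilityMeasure (ProbabilityMeasure (ProbabilityMeasure X))) :
    probJoin (probMap probJoin measurable_probJoin P) = probJoin (probJoin P) :=
  prob_ext fun s hs => by
    rw [probJoin_apply _ hs, lintegral_probMap _ _ (measurable_prob_coe hs), probJoin_apply _ hs,
      lintegral_probJoin _ (measurable_prob_coe hs)]
    exact lintegral_congr fun ν => probJoin_apply ν hs

theorem probJoin_probDirac {X : Type u} [MeasurableSpace X] (μ : ProbabilityMeasure X) :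
    probJoin (probDirac μ) = μ :=
  prob_ext fun s hs => by
    rw [probJoin_apply _ hs]
    exact lintegral_dirac' _ (measurable_prob_coe hs)

theorem probJoin_probMap_probDirac {X : Type u} [MeasurableSpace X] (μ : ProbabilityMeasure X) :
    probJoin (probMap probDirac measurable_probDirac μ) = μ :=
  prob_ext fun s hs => by
    rw [probJoin_apply _ hs, lintegral_probMap _ _ (measurable_prob_coe hs)]
    refine (lintegral_congr fun x => Measure.dirac_apply' x hs).trans ?_
    exact lintegral_indicator_one hs

/-- The functor sending a measurable space to its space of probability measures, with the
`σ`-algebra generated by the evaluations at measurable sets. -/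
def giryFunctor : MeasCat.{u} ⥤ MeasCat.{u} where
  obj X := MeasCat.of (ProbabilityMeasure X)
  map f := ⟨probMap f.1 f.2, measurable_probMap f.2⟩
  map_id _ := Subtype.ext <| funext fun _ => Subtype.ext <| Measure.map_id
  map_comp f g := Subtype.ext <| funext fun _ => Subtype.ext <| (Measure.map_map g.2 f.2).symm

/-- The Giry monad of probability measures: the unit is given by Dirac measures, the
multiplication by averaging. -/
def giryMonad : Monad MeasCat.{u} where
  toFunctor := giryFunctor
  η :=
    { app := fun _ => ⟨probDirac, measurable_probDirac⟩
      naturality := fun _ _ f => Subtype.ext <| funext fun x => (probMap_probDirac f.2 x).symm }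
  μ :=
    { app := fun _ => ⟨probJoin, measurable_probJoin⟩
      naturality := fun _ _ f => Subtype.ext <| funext fun P => probJoin_probMap_probMap f.2 P }
  assoc _ := Subtype.ext <| funext fun P => probJoin_probMap_probJoin P
  left_unit _ := Subtype.ext <| funext fun μ => probJoin_probDirac μ
  right_unit _ := Subtype.ext <| funext fun μ => probJoin_probMap_probDirac μ

end Giry

section Distribution

/-- The discrete distribution monad `D` on sets: `D X` is the set of maps `p : X → [0,1]` with
`∑ x, p x = 1`, with Dirac distributions as unit and averaging as multiplication. -/
def distMonad : Monad (Type u) := ofTypeMonad PMF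

/-- The `σ`-algebra on `D X` as a subspace of the power `[0,1]^X`; the values of a `PMF` lie in
`ℝ≥0∞`, of which `[0,1]` is a measurable subspace. -/
@[reducible] def distMeasurableSpace (X : Type u) : MeasurableSpace (PMF X) :=
  MeasurableSpace.comap (fun p x => p x) MeasurableSpace.pi

/-- The set of discrete distributions on `X` as a measurable space. -/
def distSpace (X : Type u) : MeasCat.{u} :=
  @MeasCat.of (PMF X) (distMeasurableSpace X)

theorem measurable_dist_bind {X Y : Type u} [Countable X] (f : X → PMF Y) :
    @Measurable _ _ (distMeasurableSpace X) (distMeasurableSpace Y) fun p => p.bind f := by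
  let _ := distMeasurableSpace X
  have hX : ∀ x, Measurable fun p : PMF X => p x := fun x =>
    (measurable_pi_apply x).comp (comap_measurable _)
  refine measurable_comap_iff.2 (measurable_pi_lambda _ fun y => ?_)
  simp only [Function.comp_def, PMF.bind_apply]
  exact Measurable.tsum fun x => (hX x).mul_const _

/-- A Kleisli morphism of `D` as a function. -/
def kleisliFun {X Y : Kleisli distMonad.{u}} (f : X ⟶ Y) : X.of → PMF Y.of :=
  fun x => f.of x

/-- The action of the functor `D` on maps is the pushforward of distributions. -/
theorem distMonad_map_apply {X Y : Type u} (f : X ⟶ Y) (p : PMF X) :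
    distMonad.map f p = p.map f := rfl

/-- The map `μ ∘ D f` of a Kleisli morphism `f` sends `p` to `y ↦ ∑ x, p x * f x y`. -/
theorem fromKleisli_map_apply {X Y : Kleisli distMonad.{u}} (f : X ⟶ Y) (p : PMF X.of) :
    (Kleisli.Adjunction.fromKleisli distMonad).map f p = p.bind (kleisliFun f) :=
  PMF.bind_map p (kleisliFun f) id

theorem bind_kleisliFun_comp {X Y Z : Kleisli distMonad.{u}} (f : X ⟶ Y) (g : Y ⟶ Z)
    (p : PMF X.of) :
    p.bind (kleisliFun (f ≫ g)) = (p.bind (kleisliFun f)).bind (kleisliFun g) := by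
  rw [PMF.bind_bind]
  congr 1
  funext x
  exact fromKleisli_map_apply g (kleisliFun f x)

/-- The category of countable sets. -/
abbrev CountableSet : Type (u + 1) :=
  ObjectProperty.FullSubcategory fun X : Type u => Countable X

/-- The functor `D` from countable sets to measurable spaces. -/
def distFunctor : CountableSet.{u} ⥤ MeasCat.{u} where
  obj X := distSpace X.obj
  map {X _} f := ⟨fun p : PMF X.obj => p.map f.hom,
    have := X.property
    measurable_dist_bind (PMF.pure ∘ f.hom)⟩
  map_id _ := Subtype.ext <| funext fun p => PMF.map_id p
  map_comp f g := Subtype.ext <| funext fun p => (PMF.map_comp f.hom p g.hom).symm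

/-- The full subcategory of the Kleisli category of `D` given by the countable sets. -/
abbrev CountableKleisli : Type (u + 1) :=
  ObjectProperty.FullSubcategory fun X : Kleisli distMonad.{u} => Countable X.of

/-- The forgetful functor `X ↦ D X`, `f ↦ μ ∘ D f`, from the Kleisli category of `D` on countable
sets, with values in measurable spaces. -/
def kleisliForget : CountableKleisli.{u} ⥤ MeasCat.{u} where
  obj X := distSpace X.obj.of
  map {X _} f := ⟨fun p : PMF X.obj.of => p.bind (kleisliFun f.hom),
    have := X.property
    measurable_dist_bind (kleisliFun f.hom)⟩
  map_id _ := Subtype.ext <| funext fun p => PMF.bind_pure p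
  map_comp f g := Subtype.ext <| funext fun p => bind_kleisliFun_comp f.hom g.hom p

end Distribution

end Codensity

end

/-!
Averaging a random distribution makes each `D A` an algebra of the Giry monad `G`, naturally in
Kleisli maps. Both functors thus factor through `G`-algebras, and such a factorization
makes `G` an extension compatible with unit and multiplication; what remains is to see that it is
the pointwise Kan extension.

A point of the limit computing this Kan extension at `X` assigns to each measurable `X → D A` a
distribution on `A`, naturally in `A`. On two-point sets this is a functional on measurable
functions `X → [0, 1]`, and naturality along maps of countable sets makes it countably additive. On
indicators such a functional is a probability measure `μ`. To see that it is integration against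
`μ`, split off binary digits: `2 g` is an indicator plus another `[0, 1]`-valued function, so any
discrepancy between the two functionals is halved at each step.

The limit for Kleisli maps runs over the same objects with more arrows, so its cones are among those
already classified.
-/

noncomputable section

namespace Codensity

open scoped ENNReal

section Categorical

open Functor Limits

variable {A : Type u₁} [Category.{v₁} A] {C : Type u₂} [Category.{v₂} C] {T : Monad C}

theorem isCodensityMonadOf_of_isPointwise {F : A ⥤ C} (ε : F ⋙ T.toFunctor ⟶ F)
    (hε : (RightExtension.mk T.toFunctor ε).IsPointwiseRightKanExtension)
    (hη : ∀ a, T.η.app (F.obj a) ≫ ε.app a = 𝟙 (F.obj a))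
    (hμ : ∀ a, T.μ.app (F.obj a) ≫ ε.app a = T.map (ε.app a) ≫ ε.app a) :
    IsCodensityMonadOf T F := by
  have hF : F.HasPointwiseRightKanExtension F := hε.hasPointwiseRightKanExtension
  have : T.toFunctor.IsRightKanExtension ε := hε.isRightKanExtension
  let R := F.rightKanExtension F
  let φ := F.rightKanExtensionCounit F
  let e : T.toFunctor ≅ R := T.toFunctor.rightKanExtensionUnique ε R φ
  have e_fac (a : A) : e.hom.app (F.obj a) ≫ φ.app a = ε.app a := by simp [e, R, φ]
  have unit_comp : T.η ≫ e.hom = unit F := ran_hom_ext_app F _ _ fun a => by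
    rw [NatTrans.comp_app, Category.assoc, e_fac, hη, unit_fac]
  have mult_comp : T.μ ≫ e.hom = whiskerRight e.hom T.toFunctor ≫ whiskerLeft R e.hom ≫ mult F :=
    ran_hom_ext_app F _ _ fun a => by
      have e_nat := e.hom.naturality (φ.app a)
      simp only [NatTrans.comp_app, whiskerRight_app, whiskerLeft_app, Category.assoc, mult_fac]
      rw [e_fac, hμ, ← reassoc_of% e_nat, e_fac, ← Functor.map_comp_assoc, e_fac]
  refine ⟨hF, ⟨MonadIso.mk (N := codensityMonad F) e (NatTrans.congr_app unit_comp) fun X => ?_⟩⟩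
  rw [Category.assoc]
  exact NatTrans.congr_app mult_comp X

/-- For a functor `F` into the algebras of `T` with underlying functor `U` into the base category,
the algebra structures `T (U a) ⟶ U a` make `T` a right extension of `U` along itself. -/
def algebraExtension (F : A ⥤ T.Algebra) : (F ⋙ T.forget).RightExtension (F ⋙ T.forget) :=
  RightExtension.mk T.toFunctor
    { app a := (F.obj a).a
      naturality _ _ f := (F.map f).h }

theorem isCodensityMonadOf_comp_forget (F : A ⥤ T.Algebra)
    (hF : (algebraExtension F).IsPointwiseRightKanExtension) :
    IsCodensityMonadOf T (F ⋙ T.forget) :=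
  isCodensityMonadOf_of_isPointwise (algebraExtension F).hom hF (fun a => (F.obj a).unit)
    fun a => (F.obj a).assoc

/-- A cone is a limit as soon as its restriction along an essentially surjective functor is one. The
functor need not be initial: only cones over the whole diagram have to be lifted. -/
def isLimitOfWhiskerEssSurj {J : Type*} {K : Type*} [Category* J] [Category* K] (P : J ⥤ K)
    [P.EssSurj] {D : K ⥤ C} (c : Cone D) (hc : IsLimit (c.whisker P)) : IsLimit c where
  lift s := hc.lift (s.whisker P)
  fac s k := by
    rw [← c.w (P.objObjPreimageIso k).hom, ← s.w (P.objObjPreimageIso k).hom]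
    exact hc.fac_assoc (s.whisker P) (P.objPreimage k) _
  uniq s m hm := hc.uniq (s.whisker P) m fun j => hm (P.obj j)

/-- Being a pointwise right Kan extension may be checked after restriction along an essentially
surjective functor. -/
def isPointwiseOfEssSurjComp {B : Type*} [Category* B] (I : B ⥤ A) [I.EssSurj] (F : A ⥤ T.Algebra)
    (h : (algebraExtension (I ⋙ F)).IsPointwiseRightKanExtension) :
    (algebraExtension F).IsPointwiseRightKanExtension :=
  fun X => isLimitOfWhiskerEssSurj (StructuredArrow.pre X I (F ⋙ T.forget)) _ (h X)

end Categorical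

/-- A measurable `[0, 1]`-valued function, with values taken in `ℝ≥0∞` to match those of a `PMF`. -/
structure Effect (X : Type*) [MeasurableSpace X] where
  toFun : X → ℝ≥0∞
  measurable : Measurable toFun
  le_one : ∀ x, toFun x ≤ 1

namespace Effect

variable {X : Type*} [MeasurableSpace X]

instance : CoeFun (Effect X) fun _ => X → ℝ≥0∞ := ⟨toFun⟩

/-- The indicator function of a measurable set. -/
def indicator {s : Set X} (hs : MeasurableSet s) : Effect X where
  toFun := s.indicator 1
  measurable := measurable_one.indicator hs
  le_one := Set.indicator_le_self' fun _ _ => zero_le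

/-- The effect `g / 2`. -/
def half (g : Effect X) : Effect X where
  toFun x := g x / 2
  measurable := g.measurable.div_const 2
  le_one x := (ENNReal.half_le_self).trans (g.le_one x)

/-- The effect `1 - g`. -/
def compl (g : Effect X) : Effect X where
  toFun x := 1 - g x
  measurable := g.measurable.const_sub 1
  le_one _ := tsub_le_self

/-- The set where the first binary digit of `g` is `1`. -/
def digitSet (g : Effect X) : Set X := {x | 2⁻¹ ≤ g x}

theorem measurableSet_digitSet (g : Effect X) : MeasurableSet g.digitSet :=
  measurableSet_le measurable_const g.measurable

/-- What remains of `g` after the removal of its first binary digit, scaled back to `[0, 1]`. -/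
def remainder (g : Effect X) : Effect X where
  toFun x := 2 * g x - indicator g.measurableSet_digitSet x
  measurable := (g.measurable.const_mul 2).sub (indicator _).measurable
  le_one x := by
    by_cases hx : x ∈ g.digitSet
    · have : 2 * g x ≤ 1 + 1 := by
        simpa [one_add_one_eq_two] using mul_le_mul_right (g.le_one x) 2
      simpa [indicator, hx] using this
    · have : g x ≤ 2⁻¹ := (not_le.1 hx).le
      simpa [indicator, hx, ENNReal.le_inv_iff_mul_le, mul_comm] using this

theorem two_mul_eq_indicator_add_remainder (g : Effect X) (x : X) :
    2 * g x = indicator g.measurableSet_digitSet x + g.remainder x := by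
  refine (add_tsub_cancel_of_le ?_).symm
  refine Set.indicator_le' (f := 1) (g := fun x => 2 * g x) (fun x hx => ?_) (fun _ _ => zero_le) x
  have := mul_le_mul_right (show 2⁻¹ ≤ g x from hx) 2
  rwa [ENNReal.mul_inv_cancel (by simp) (by simp)] at this

theorem indicator_iUnion {ι : Type*} [Countable ι] {s : ι → Set X} (hs : ∀ i, MeasurableSet (s i))
    (hd : Pairwise (Function.onFun Disjoint s)) (x : X) :
    indicator (MeasurableSet.iUnion hs) x = ∑' i, indicator (hs i) x := by
  by_cases hx : x ∈ ⋃ i, s i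
  · obtain ⟨i, hi⟩ := Set.mem_iUnion.1 hx
    have hne (j : ι) (hj : j ≠ i) : indicator (hs j) x = 0 :=
      Set.indicator_of_notMem (fun h => Set.disjoint_left.1 (hd hj) h hi) _
    rw [tsum_eq_single i hne]
    simp [indicator, hx, hi]
  · simp_all [indicator]

end Effect

/-- A functional on effects is countably additive if it preserves all those countable sums that are
again effects. -/
def CountablyAdditive {X : Type*} [MeasurableSpace X] (Φ : Effect X → ℝ≥0∞) : Prop :=
  ∀ (ι : Type) [Countable ι] (g : ι → Effect X) (h : Effect X),
    (∀ x, h x = ∑' i, g i x) → Φ h = ∑' i, Φ (g i)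

theorem countablyAdditive_lintegral {X : Type*} [MeasurableSpace X] (μ : Measure X) :
    CountablyAdditive fun g : Effect X => ∫⁻ x, g x ∂μ :=
  fun ι _ g h hsum => by
    simp only [hsum]
    exact lintegral_tsum fun i => (g i).measurable.aemeasurable

namespace CountablyAdditive

variable {X : Type*} [MeasurableSpace X] {Φ Ψ : Effect X → ℝ≥0∞}

open Effect

theorem map_add (hΦ : CountablyAdditive Φ) {f g h : Effect X} (hsum : ∀ x, h x = f x + g x) :
    Φ h = Φ f + Φ g := by
  simpa using hΦ Bool (fun b => cond b f g) h fun x => by simp [hsum]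

theorem map_indicator_empty (hΦ : CountablyAdditive Φ) : Φ (indicator MeasurableSet.empty) = 0 := by
  simpa using hΦ Empty Empty.elim (indicator MeasurableSet.empty) (by simp [indicator])

theorem le_map_univ (hΦ : CountablyAdditive Φ) (g : Effect X) :
    Φ g ≤ Φ (indicator MeasurableSet.univ) := by
  have h := hΦ.map_add (f := g) (g := g.compl) (h := indicator MeasurableSet.univ) fun x => by
    simpa [indicator, Effect.compl] using (add_tsub_cancel_of_le (g.le_one x)).symm
  exact h ▸ le_self_add

theorem two_mul_map_half (hΦ : CountablyAdditive Φ) (g : Effect X) : 2 * Φ g.half = Φ g := by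
  rw [two_mul, ← hΦ.map_add fun x => (ENNReal.add_halves (g x)).symm]

theorem two_mul_map (hΦ : CountablyAdditive Φ) {f g h : Effect X}
    (hsum : ∀ x, 2 * h x = f x + g x) : 2 * Φ h = Φ f + Φ g := by
  have hhalf : Φ h = Φ f.half + Φ g.half := hΦ.map_add fun x => by
    change h x = f x / 2 + g x / 2
    rw [← ENNReal.add_div, ← hsum, mul_comm, ENNReal.mul_div_cancel_right (by simp) (by simp)]
  rw [hhalf, mul_add, hΦ.two_mul_map_half, hΦ.two_mul_map_half]

-- Removing one binary digit of `g` halves the defect of the inequality `Φ g ≤ Ψ g`.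
theorem le_add_inv_two_pow (hΦ : CountablyAdditive Φ) (hΨ : CountablyAdditive Ψ)
    (hle : ∀ (s : Set X) (hs : MeasurableSet s), Φ (indicator hs) ≤ Ψ (indicator hs))
    (n : ℕ) (g : Effect X) :
    Φ g ≤ Ψ g + 2⁻¹ ^ n * Φ (indicator MeasurableSet.univ) := by
  induction n generalizing g with
  | zero => simpa using le_add_left (hΦ.le_map_univ g)
  | succ n ih =>
    set c := Φ (indicator MeasurableSet.univ)
    refine (ENNReal.mul_le_mul_iff_right two_ne_zero ENNReal.ofNat_ne_top).1 ?_
    calc 2 * Φ g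
        = Φ (indicator g.measurableSet_digitSet) + Φ g.remainder :=
          hΦ.two_mul_map g.two_mul_eq_indicator_add_remainder
      _ ≤ Ψ (indicator g.measurableSet_digitSet) + (Ψ g.remainder + 2⁻¹ ^ n * c) :=
          add_le_add (hle _ _) (ih _)
      _ = 2 * Ψ g + 2 * 2⁻¹ * (2⁻¹ ^ n * c) := by
          rw [← add_assoc, ← hΨ.two_mul_map g.two_mul_eq_indicator_add_remainder,
            ENNReal.mul_inv_cancel two_ne_zero ENNReal.ofNat_ne_top, one_mul]
      _ = 2 * (Ψ g + 2⁻¹ ^ (n + 1) * c) := by ring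

theorem le_of_le_indicator (hΦ : CountablyAdditive Φ) (hΨ : CountablyAdditive Ψ)
    (hfin : Φ (indicator MeasurableSet.univ) ≠ ∞)
    (hle : ∀ (s : Set X) (hs : MeasurableSet s), Φ (indicator hs) ≤ Ψ (indicator hs))
    (g : Effect X) : Φ g ≤ Ψ g := by
  have hpow : Filter.Tendsto (fun n : ℕ => (2⁻¹ : ℝ≥0∞) ^ n) Filter.atTop (nhds 0) :=
    ENNReal.tendsto_pow_atTop_nhds_zero_of_lt_one (by simp)
  have hlim := (ENNReal.Tendsto.mul_const hpow (.inr hfin)).const_add (Ψ g)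
  rw [zero_mul, add_zero] at hlim
  exact ge_of_tendsto' hlim fun n => hΦ.le_add_inv_two_pow hΨ hle n g

theorem eq_of_eq_indicator (hΦ : CountablyAdditive Φ) (hΨ : CountablyAdditive Ψ)
    (hfin : Φ (indicator MeasurableSet.univ) ≠ ∞)
    (heq : ∀ (s : Set X) (hs : MeasurableSet s), Φ (indicator hs) = Ψ (indicator hs)) :
    Φ = Ψ :=
  funext fun g => le_antisymm (hΦ.le_of_le_indicator hΨ hfin (fun s hs => (heq s hs).le) g)
    (hΨ.le_of_le_indicator hΦ (heq _ _ ▸ hfin) (fun s hs => (heq s hs).ge) g)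

/-- The measure `s ↦ Φ 1ₛ`. -/
def measure (hΦ : CountablyAdditive Φ) : Measure X :=
  Measure.ofMeasurable (fun _ hs => Φ (indicator hs)) hΦ.map_indicator_empty
    fun _ hs hd => hΦ ℕ _ _ (indicator_iUnion hs hd)

theorem measure_apply (hΦ : CountablyAdditive Φ) {s : Set X} (hs : MeasurableSet s) :
    hΦ.measure s = Φ (indicator hs) :=
  Measure.ofMeasurable_apply s hs

theorem lintegral_measure (hΦ : CountablyAdditive Φ)
    (hfin : Φ (indicator MeasurableSet.univ) ≠ ∞) (g : Effect X) :
    ∫⁻ x, g x ∂hΦ.measure = Φ g := by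
  refine (congrFun (hΦ.eq_of_eq_indicator (countablyAdditive_lintegral hΦ.measure) hfin
    fun s hs => ?_) g).symm
  exact ((lintegral_indicator_one hs).trans (hΦ.measure_apply hs)).symm

theorem isProbabilityMeasure_measure (hΦ : CountablyAdditive Φ)
    (h1 : Φ (indicator MeasurableSet.univ) = 1) : IsProbabilityMeasure hΦ.measure :=
  ⟨(hΦ.measure_apply MeasurableSet.univ).trans h1⟩

end CountablyAdditive

section Completion

variable {A : Type*}

theorem tsum_option_eq_add (g : Option A → ℝ≥0∞) : ∑' o, g o = g none + ∑' a, g (some a) := by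
  rw [← (Equiv.optionEquivSumPUnit.{0} A).symm.tsum_eq g,
    Summable.tsum_sum ENNReal.summable ENNReal.summable, add_comm]
  simp

/-- A subdistribution on `A`, completed to a distribution on `Option A`: the missing mass is put on
`none`. -/
def completion (g : A → ℝ≥0∞) (hg : ∑' a, g a ≤ 1) : PMF (Option A) :=
  ⟨fun o => o.elim (1 - ∑' a, g a) g, by
    rw [Summable.hasSum_iff ENNReal.summable, tsum_option_eq_add]
    exact tsub_add_cancel_of_le hg⟩

theorem dist_option_ext {p q : PMF (Option A)} (h : ∀ a, p (some a) = q (some a)) : p = q := by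
  have none_add (r : PMF (Option A)) : r none + ∑' a, r (some a) = 1 :=
    (tsum_option_eq_add r).symm.trans r.tsum_coe
  have hfin : ∑' a, q (some a) ≠ ∞ :=
    ne_top_of_le_ne_top ENNReal.one_ne_top (none_add q ▸ le_add_self)
  have hnone : p none = q none := by
    refine (ENNReal.add_left_inj hfin).1 ?_
    rw [none_add q, ← none_add p, tsum_congr h]
  ext o
  cases o with
  | none => exact hnone
  | some a => exact h a

theorem toOuterMeasure_range_some (p : PMF (Option A)) :
    p.toOuterMeasure (Set.range some) = ∑' a, p (some a) := by
  rw [PMF.toOuterMeasure_apply, ← tsum_subtype, tsum_range _ (Option.some_injective _)]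

open Classical in
/-- The characteristic function of `s`, with `none` for false and `some` for true. -/
def characteristic (s : Set A) (a : A) : Option PUnit.{u + 1} :=
  if a ∈ s then some PUnit.unit else none

theorem map_characteristic_apply (p : PMF A) (s : Set A) :
    p.map (characteristic s) (some PUnit.unit) = p.toOuterMeasure s := by
  have hpre : characteristic s ⁻¹' {some PUnit.unit} = s := by
    ext a
    by_cases h : a ∈ s <;> simp [characteristic, h]
  rw [← PMF.toOuterMeasure_apply_singleton, PMF.toOuterMeasure_map_apply, hpre]

end Completion

section Barycenter

attribute [local instance] distMeasurableSpace

variable {X A B : Type u} [MeasurableSpace X]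

theorem measurable_dist_iff {f : X → PMF A} : Measurable f ↔ ∀ a, Measurable fun x => f x a :=
  measurable_comap_iff.trans measurable_pi_iff

theorem measurable_dist_apply (a : A) : Measurable fun p : PMF A => p a :=
  measurable_dist_iff.1 measurable_id a

theorem measurable_dist_map [Countable A] (k : A → B) {f : X → PMF A} (hf : Measurable f) :
    Measurable fun x => (f x).map k :=
  (measurable_dist_bind (PMF.pure ∘ k)).comp hf

theorem measurable_completion [Countable A] {g : X → A → ℝ≥0∞}
    (hg : ∀ a, Measurable fun x => g x a) (hg1 : ∀ x, ∑' a, g x a ≤ 1) :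
    Measurable fun x => completion (g x) (hg1 x) :=
  measurable_dist_iff.2 fun o => match o with
    | none => (Measurable.tsum hg).const_sub 1
    | some a => hg a

variable [Countable A] [Countable B]

/-- The mean value of a random distribution. -/
def barycenter (P : ProbabilityMeasure (PMF A)) : PMF A :=
  ⟨fun a => ∫⁻ p, p a ∂(P : Measure (PMF A)), by
    rw [Summable.hasSum_iff ENNReal.summable,
      ← lintegral_tsum fun a => (measurable_dist_apply a).aemeasurable]
    simp only [PMF.tsum_coe, lintegral_const, measure_univ, mul_one]⟩

theorem barycenter_apply (P : ProbabilityMeasure (PMF A)) (a : A) :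
    barycenter P a = ∫⁻ p, p a ∂(P : Measure (PMF A)) := rfl

theorem measurable_barycenter : Measurable (barycenter : ProbabilityMeasure (PMF A) → PMF A) :=
  measurable_dist_iff.2 fun a =>
    (Measure.measurable_lintegral (measurable_dist_apply a)).comp measurable_prob_toMeasure

theorem barycenter_probMap_apply {f : X → PMF A} (hf : Measurable f) (μ : ProbabilityMeasure X)
    (a : A) : barycenter (probMap f hf μ) a = ∫⁻ x, f x a ∂(μ : Measure X) :=
  lintegral_probMap hf μ (measurable_dist_apply a)

theorem barycenter_probMap_bind (k : A → PMF B) (P : ProbabilityMeasure (PMF A)) :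
    barycenter (probMap (fun p => p.bind k) (measurable_dist_bind k) P) =
      (barycenter P).bind k := by
  ext b
  rw [barycenter_probMap_apply]
  simp only [PMF.bind_apply, barycenter_apply]
  rw [lintegral_tsum fun a => ((measurable_dist_apply a).mul_const _).aemeasurable]
  exact tsum_congr fun a => lintegral_mul_const _ (measurable_dist_apply a)

theorem barycenter_probDirac (p : PMF A) : barycenter (probDirac p) = p := by
  ext a
  exact lintegral_dirac' p (measurable_dist_apply a)

theorem barycenter_probJoin (P : ProbabilityMeasure (ProbabilityMeasure (PMF A))) :
    barycenter (probJoin P) = barycenter (probMap barycenter measurable_barycenter P) := by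
  ext a
  rw [barycenter_probMap_apply]
  exact lintegral_probJoin P (measurable_dist_apply a)

/-- The effect `g` as a family of distributions on two points, with mass `g x` on `some` and
`1 - g x` on `none`. -/
def Effect.dist (g : Effect X) (x : X) : PMF (Option PUnit.{u + 1}) :=
  completion (fun _ => g x) (by simpa using g.le_one x)

theorem Effect.measurable_dist (g : Effect X) : Measurable g.dist :=
  measurable_completion (fun _ => g.measurable) _

theorem Effect.barycenter_probMap_dist (g : Effect X) (μ : ProbabilityMeasure X) :
    barycenter (probMap g.dist g.measurable_dist μ) (some PUnit.unit) =
      ∫⁻ x, g x ∂(μ : Measure X) :=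
  barycenter_probMap_apply g.measurable_dist μ _

theorem barycenter_probMap_dist_indicator (μ : ProbabilityMeasure X) {s : Set X}
    (hs : MeasurableSet s) :
    barycenter (probMap _ (Effect.indicator hs).measurable_dist μ) (some PUnit.unit) =
      (μ : Measure X) s :=
  (Effect.barycenter_probMap_dist _ μ).trans (lintegral_indicator_one hs)

theorem prob_ext_of_barycenter {μ ν : ProbabilityMeasure X}
    (h : ∀ (A : Type u) [Countable A] (f : X → PMF A) (hf : Measurable f),
      barycenter (probMap f hf μ) = barycenter (probMap f hf ν)) : μ = ν :=
  prob_ext fun s hs => by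
    rw [← barycenter_probMap_dist_indicator μ hs, ← barycenter_probMap_dist_indicator ν hs, h]

end Barycenter

section AveragingFamily

attribute [local instance] distMeasurableSpace

/-- A choice of a distribution on `A` for every measurable map `X → D A` into the distributions on
a countable set `A`, natural in `A`. These are the points of the limit that computes the right
Kan extension of `D` along itself at `X`. -/
structure AveragingFamily (X : Type u) [MeasurableSpace X] where
  avg : ∀ {A : Type u} [Countable A] (f : X → PMF A), Measurable f → PMF A
  avg_map : ∀ {A B : Type u} [Countable A] [Countable B] (k : A → B) (f : X → PMF A)
    (hf : Measurable f), avg (fun x => (f x).map k) (measurable_dist_map k hf) = (avg f hf).map k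

namespace AveragingFamily

variable {X : Type u} [MeasurableSpace X] (α : AveragingFamily X)

/-- The functional on effects given by the members of the family with values in two points. -/
def functional (g : Effect X) : ℝ≥0∞ := α.avg g.dist g.measurable_dist (some PUnit.unit)

theorem functional_eq_toOuterMeasure {A : Type u} [Countable A] {f : X → PMF A} (hf : Measurable f)
    {s : Set A} {g : Effect X} (hg : ∀ x, g x = (f x).toOuterMeasure s) :
    α.functional g = (α.avg f hf).toOuterMeasure s := by
  have hdist : g.dist = fun x => (f x).map (characteristic s) := funext fun x =>
    dist_option_ext fun _ => (hg x).trans (map_characteristic_apply _ _).symm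
  simp only [functional, hdist]
  rw [α.avg_map (characteristic s) f hf, map_characteristic_apply]

theorem functional_eq_apply {A : Type u} [Countable A] {f : X → PMF A} (hf : Measurable f)
    {a : A} {g : Effect X} (hg : ∀ x, g x = f x a) : α.functional g = α.avg f hf a := by
  rw [← PMF.toOuterMeasure_apply_singleton]
  exact α.functional_eq_toOuterMeasure hf fun x =>
    (hg x).trans (PMF.toOuterMeasure_apply_singleton _ _).symm

theorem functional_tsum {A : Type u} [Countable A] {g : A → Effect X} {h : Effect X}
    (hsum : ∀ x, h x = ∑' a, g a x) : α.functional h = ∑' a, α.functional (g a) := by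
  have hle (x : X) : ∑' a, g a x ≤ 1 := hsum x ▸ h.le_one x
  have hmeas := measurable_completion (fun a => (g a).measurable) hle
  calc α.functional h
      = (α.avg _ hmeas).toOuterMeasure (Set.range some) :=
        α.functional_eq_toOuterMeasure hmeas fun x =>
          (hsum x).trans (toOuterMeasure_range_some (completion _ (hle x))).symm
    _ = ∑' a, α.avg _ hmeas (some a) := toOuterMeasure_range_some _
    _ = ∑' a, α.functional (g a) :=
        tsum_congr fun a => (α.functional_eq_apply hmeas fun _ => rfl).symm

theorem countablyAdditive_functional : CountablyAdditive α.functional :=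
  fun ι _ g h hsum => by
    rw [← Equiv.ulift.{u}.tsum_eq fun i => α.functional (g i)]
    exact α.functional_tsum fun x => (hsum x).trans (Equiv.ulift.tsum_eq fun i => g i x).symm

theorem functional_univ : α.functional (Effect.indicator MeasurableSet.univ) = 1 := by
  have hunit (p : PMF PUnit.{u + 1}) : p.toOuterMeasure Set.univ = 1 :=
    (p.toOuterMeasure_apply_eq_one_iff _).2 (Set.subset_univ _)
  rw [α.functional_eq_toOuterMeasure (f := fun _ => PMF.pure PUnit.unit) measurable_const
    (s := Set.univ) fun x => by simp [hunit, Effect.indicator], hunit]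

theorem exists_prob_barycenter_eq :
    ∃ μ : ProbabilityMeasure X, ∀ (A : Type u) [Countable A] (f : X → PMF A) (hf : Measurable f),
      barycenter (probMap f hf μ) = α.avg f hf := by
  have hΦ := α.countablyAdditive_functional
  refine ⟨⟨hΦ.measure, hΦ.isProbabilityMeasure_measure α.functional_univ⟩, fun A _ f hf => ?_⟩
  ext a
  let g : Effect X := ⟨fun x => f x a, measurable_dist_iff.1 hf a, fun x => (f x).coe_le_one a⟩
  have hfin : α.functional (Effect.indicator MeasurableSet.univ) ≠ ∞ := by
    simp [α.functional_univ]
  calc barycenter (probMap f hf _) a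
      = ∫⁻ x, g x ∂hΦ.measure := barycenter_probMap_apply hf _ a
    _ = α.functional g := hΦ.lintegral_measure hfin g
    _ = α.avg f hf a := α.functional_eq_apply hf fun _ => rfl

theorem exists_measurable_barycenter_eq {Y : Type u} [MeasurableSpace Y] (α : Y → AveragingFamily X)
    (hα : ∀ (A : Type u) [Countable A] (f : X → PMF A) (hf : Measurable f),
      Measurable fun y => (α y).avg f hf) :
    ∃ l : Y → ProbabilityMeasure X, Measurable l ∧
      ∀ (A : Type u) [Countable A] (f : X → PMF A) (hf : Measurable f) (y : Y),
        barycenter (probMap f hf (l y)) = (α y).avg f hf := by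
  choose l hl using fun y => (α y).exists_prob_barycenter_eq
  refine ⟨l, measurable_of_measurable_prob_coe _ fun s hs => ?_, fun A _ f hf y => hl y A f hf⟩
  simp only [← barycenter_probMap_dist_indicator _ hs, hl]
  exact measurable_dist_iff.1 (hα _ _ _) _

end AveragingFamily

end AveragingFamily

section Functors

attribute [local instance] distMeasurableSpace

/-- Distributions on a countable set as an algebra of the Giry monad. -/
def distAlgebra (A : Type u) [Countable A] : giryMonad.{u}.Algebra where
  A := distSpace A
  a := ⟨barycenter, measurable_barycenter⟩
  unit := Subtype.ext <| funext barycenter_probDirac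
  assoc := Subtype.ext <| funext barycenter_probJoin

/-- The lift of `kleisliForget` to the algebras of the Giry monad. -/
def kleisliAlgebra : CountableKleisli.{u} ⥤ giryMonad.{u}.Algebra where
  obj A := have := A.property; distAlgebra A.obj.of
  map {A B} f :=
    { f := kleisliForget.map f
      h := Subtype.ext <| funext fun P =>
        have := A.property
        have := B.property
        barycenter_probMap_bind (kleisliFun f.hom) P }
  map_id A := Monad.Algebra.Hom.ext (kleisliForget.map_id A)
  map_comp f g := Monad.Algebra.Hom.ext (kleisliForget.map_comp f g)

/-- The inclusion of the maps of countable sets into the Kleisli category of `D`. -/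
def countableToKleisli : CountableSet.{u} ⥤ CountableKleisli.{u} :=
  ObjectProperty.lift _ (ObjectProperty.ι _ ⋙ Kleisli.Adjunction.toKleisli distMonad)
    fun A => A.property

instance : countableToKleisli.{u}.EssSurj where
  mem_essImage A := ⟨⟨A.obj.of, A.property⟩, ⟨Iso.refl A⟩⟩

/-- The lift of `distFunctor` to the algebras of the Giry monad. -/
abbrev countableAlgebra : CountableSet.{u} ⥤ giryMonad.{u}.Algebra :=
  countableToKleisli ⋙ kleisliAlgebra

/-- A measurable map `X → D A` as an object of the comma category of `X` and `D`. -/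
def distArrow {X : MeasCat.{u}} {A : Type u} [hA : Countable A] (f : X → PMF A)
    (hf : Measurable f) : StructuredArrow X (countableAlgebra ⋙ giryMonad.forget) :=
  let B : CountableSet := ⟨A, hA⟩
  let f' : X ⟶ (countableAlgebra ⋙ giryMonad.forget).obj B := ⟨f, hf⟩
  StructuredArrow.mk f'

/-- The values at the point `y` of the legs of a cone over the measurable maps `X → D A`. -/
def coneFamily {X : MeasCat.{u}} (s : Limits.Cone
    (StructuredArrow.proj X (countableAlgebra ⋙ giryMonad.forget) ⋙
      countableAlgebra ⋙ giryMonad.forget)) (y : s.pt) : AveragingFamily X where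
  avg f hf := (s.π.app (distArrow f hf)).1 y
  avg_map k f hf :=
    let φ : distArrow f hf ⟶ distArrow (fun x => (f x).map k) (measurable_dist_map k hf) :=
      StructuredArrow.homMk ⟨TypeCat.ofHom k⟩ rfl
    (congrFun (congrArg Subtype.val (s.w φ)) y).symm

/-- The Giry monad is the pointwise right Kan extension of `D` along itself. -/
def giryIsPointwise : (algebraExtension countableAlgebra.{u}).IsPointwiseRightKanExtension :=
  fun X => Limits.IsLimit.ofExistsUnique fun s => by
    obtain ⟨l, hl, h⟩ := AveragingFamily.exists_measurable_barycenter_eq (coneFamily s)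
      fun A _ f hf => (s.π.app (distArrow f hf)).2
    refine ⟨⟨l, hl⟩, fun j => Subtype.ext <| funext fun y => ?_,
      fun l' hl' => Subtype.ext <| funext fun y => prob_ext_of_barycenter fun A _ f hf => ?_⟩
    · have := j.right.property
      exact h j.right.obj _ j.hom.2 y
    · exact (congrFun (congrArg Subtype.val (hl' (distArrow f hf))) y).trans (h A f hf y).symm

end Functors

end Codensity

end

theorem theorem6p9 :
    Codensity.IsCodensityMonadOf Codensity.giryMonad.{u} Codensity.distFunctor.{u} ∧
    Codensity.IsCodensityMonadOf Codensity.giryMonad.{u} Codensity.kleisliForget.{u} := by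
  constructor
  · exact Codensity.isCodensityMonadOf_comp_forget Codensity.countableAlgebra
      Codensity.giryIsPointwise
  · exact Codensity.isCodensityMonadOf_comp_forget Codensity.kleisliAlgebra <|
      Codensity.isPointwiseOfEssSurjComp Codensity.countableToKleisli Codensity.kleisliAlgebra
        Codensity.giryIsPointwise
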